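/- **Theorem (Maslov phase of a triple convolution).** Let $(\mathbb T,\omega)$ be a real symplectic vector space of dimension $2n$ and let $\mathcal L$ be its Liouville measure (the Haar measure $|\omega^n/n!|$, which gives mass $1$ to the parallelepiped of a symplectic basis). Let $h\neq 0$ be real, $e(t)=e^{\pi i t}$ and $e_h(t)=e(2ht)=e^{2\pi i h t}$. Let $\tilde{\mathfrak H}=\mathbb R\times\mathbb T$ be the Heisenberg group with product $(s,x)(s',x')=(s+s'+\tfrac12\omega(x,x'),\,x+x')$, and identify $x\in\mathbb T$ with $(0,x)\in\tilde{\mathfrak H}$. Let $\mathbb A,\mathbb B,\mathbb C\subset\mathbb T$ be pairwise complementary Lagrangian subspaces with Haar measures $\mu_{\mathbb A},\mu_{\mathbb B},\mu_{\mathbb C}$. For $\mathbb X,\mathbb Y\in\{\mathbb A,\mathbb B,\mathbb C\}$ distinct, let $\frac{d\mu_{\mathbb X}d\mu_{\mathbb Y}}{d\mathcal L}$ be the (constant) Radon–Nikodym derivative with respect to $\mathcal L$ of the image of $\mu_{\mathbb X}\times\mu_{\mathbb Y}$ under the isomorphism $\mathbb X\oplus\mathbb Y\to\mathbb T$, $(x,y)\mapsto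 x+y$. Let $\tau(\mathbb A,\mathbb B,\mathbb C)$ be the Maslov index, i.e. the number of positive minus the number of negative eigenvalues of the quadratic form $\kappa(a,b,c)=\omega(a,b)+\omega(b,c)+\omega(c,a)$ on $\mathbb A\oplus\mathbb B\oplus\mathbb C$. Let $P$ be the projection of $\mathbb T$ onto $\mathbb A$ along $\mathbb B$, let $Q=1-P$, and let $f$ be a complex-valued Schwartz function on $\mathbb A$. Put $$\Lambda=|h|^{-3n/2}\left(\frac{d\mu_{\mathbb A}d\mu_{\mathbb B}}{d\mathcal L}\cdot\frac{d\mu_{\mathbb B}d\mu_{\mathbb C}}{d\mathcal L}\cdot\frac{d\mu_{\mathbb C}d\mu_{\mathbb A}}{d\mathcal L}\right)^{1/2}.$$ (a) (Right action.) Let $\operatorname{ind}_{\mathbb{AB}}f(s,x)=e_h\!\left(s-\tfrac12\omega(Px,Qx)\right)f(Px)$ and $(\delta_{\mathbb X}*F)(z)=\int_{\mathbb X}F(z\cdot x)\,d\mu_{\mathbb X}(x)$. Then, in the iterated convolution below, all three successive integrals converge absolutely at every point, and $$\delta_{\mathbb B}*\delta_{\mathbb C}*\delta_{\mathbb A}*\operatorname{ind}_{\mathbb{AB}}f=\Lambda\;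 e\!\left(-\frac{\operatorname{sgn}(h)}{4}\,\tau(\mathbb A,\mathbb B,\mathbb C)\right)\operatorname{ind}_{\mathbb{AB}}f .$$ (b) (Left action.) Let instead $\operatorname{ind}_{\mathbb{AB}}f(s,x)=e_h\!\left(s+\tfrac12\omega(Px,x)\right)f(Px)$ and $(\delta_{\mathbb X}*F)(z)=\int_{\mathbb X}F(x^{-1}\cdot z)\,d\mu_{\mathbb X}(x)$. Then all three successive integrals converge absolutely at every point, and $$\delta_{\mathbb B}*\delta_{\mathbb C}*\delta_{\mathbb A}*\operatorname{ind}_{\mathbb{AB}}f=\Lambda\; e\!\left(+\frac{\operatorname{sgn}(h)}{4}\,\tau(\mathbb A,\mathbb B,\mathbb C)\right)\operatorname{ind}_{\mathbb{AB}}f .$$ -/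

import Mathlib

open MeasureTheory
open scoped SchwartzMap

noncomputable section

/-- A symplectic form: an alternating nondegenerate real bilinear form. -/
def IsSymplecticForm {T : Type*} [AddCommGroup T] [Module ℝ T]
    (ω : LinearMap.BilinForm ℝ T) : Prop :=
  ω.IsAlt ∧ ω.Nondegenerate

/-- `X` is Lagrangian: it coincides with its own `ω`-orthogonal space. -/
def IsLagrangian {T : Type*} [AddCommGroup T] [Module ℝ T]
    (ω : LinearMap.BilinForm ℝ T) (X : Submodule ℝ T) : Prop :=
  ∀ x : T, x ∈ X ↔ ∀ y ∈ X, ω x y = 0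

/-! ### The Heisenberg group -/

/-- The (simply connected) Heisenberg group of `(T, ω)`: the set `ℝ × T` with the product
`(s, x)(s', x') = (s + s' + ω(x, x') / 2, x + x')`. -/
@[ext]
structure Heisenberg {T : Type*} [AddCommGroup T] [Module ℝ T]
    (ω : LinearMap.BilinForm ℝ T) where
  s : ℝ
  x : T

namespace Heisenberg

variable {T : Type*} [AddCommGroup T] [Module ℝ T] {ω : LinearMap.BilinForm ℝ T}

instance : Mul (Heisenberg ω) := ⟨fun z w => ⟨z.s + w.s + ω z.x w.x / 2, z.x + w.x⟩⟩

instance : One (Heisenberg ω) := ⟨⟨0, 0⟩⟩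

/-- The term `ω(x, x) / 2` vanishes when `ω` is alternating, so that `(s, x)⁻¹ = (-s, -x)`. -/
instance : Inv (Heisenberg ω) := ⟨fun z => ⟨-z.s + ω z.x z.x / 2, -z.x⟩⟩

theorem mul_def (z w : Heisenberg ω) :
    z * w = ⟨z.s + w.s + ω z.x w.x / 2, z.x + w.x⟩ := rfl

theorem one_def : (1 : Heisenberg ω) = ⟨0, 0⟩ := rfl

theorem inv_def (z : Heisenberg ω) : z⁻¹ = ⟨-z.s + ω z.x z.x / 2, -z.x⟩ := rfl

instance : Group (Heisenberg ω) :=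
  Group.ofLeftAxioms
    (by
      intro a b c
      ext
      · simp only [mul_def, map_add, LinearMap.add_apply]; ring
      · simp only [mul_def]; abel)
    (by intro a; ext <;> simp [mul_def, one_def])
    (by
      intro a
      ext
      · simp only [mul_def, inv_def, one_def, map_neg, LinearMap.neg_apply]; ring
      · simp [mul_def, inv_def, one_def])

theorem inv_eq_of_isAlt (hω : ω.IsAlt) (z : Heisenberg ω) : z⁻¹ = ⟨-z.s, -z.x⟩ := by
  ext
  · simp [inv_def, hω z.x]
  · rfl

/-- The inclusion `x ↦ (0, x)` of `T`. On an isotropic subspace it is a homomorphism. -/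
def ofVec (ω : LinearMap.BilinForm ℝ T) (x : T) : Heisenberg ω := ⟨0, x⟩

end Heisenberg

/-- The character `e(t) = exp(π i t)`. -/
def eChar (t : ℝ) : ℂ := Complex.exp (Real.pi * Complex.I * t)

/-- The central character `e_h(t) = e(2 h t) = exp(2 π i h t)`. -/
def ehChar (h t : ℝ) : ℂ := eChar (2 * h * t)

/-! ### Induction and convolution with Lagrangian distributions -/

section Convolution

variable {T : Type*} [AddCommGroup T] [Module ℝ T]

/-- Induction from `A` to functions on the Heisenberg group that have central character `e_h` and
are invariant under right translations by `B`: the function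
`(s, x) ↦ e_h(s - ω(Px, Qx) / 2) f(Px)`, where `P` is the projection of `T = A ⊕ B` onto `A`
along `B` and `Q = 1 - P`. -/
def indRight (ω : LinearMap.BilinForm ℝ T) (h : ℝ) {A B : Submodule ℝ T} (hAB : IsCompl A B)
    (f : A → ℂ) : Heisenberg ω → ℂ := fun z =>
  ehChar h (z.s - ω (A.projectionOnto B hAB z.x) (B.projectionOnto A hAB.symm z.x) / 2) *
    f (A.projectionOnto B hAB z.x)

/-- Induction from `A` to functions on the Heisenberg group that have central character `e_h` and
are invariant under left translations by `B`: the function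
`(s, x) ↦ e_h(s + ω(Px, x) / 2) f(Px)`, where `P` is the projection of `T = A ⊕ B` onto `A`
along `B`. -/
def indLeft (ω : LinearMap.BilinForm ℝ T) (h : ℝ) {A B : Submodule ℝ T} (hAB : IsCompl A B)
    (f : A → ℂ) : Heisenberg ω → ℂ := fun z =>
  ehChar h (z.s + ω (A.projectionOnto B hAB z.x) z.x / 2) * f (A.projectionOnto B hAB z.x)

variable [MeasurableSpace T] {ω : LinearMap.BilinForm ℝ T} {X : Submodule ℝ T}

/-- `δ_X * F` for the right action: the average `z ↦ ∫_X F(z · x) dμ(x)`. -/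
def convRight (μ : Measure X) (F : Heisenberg ω → ℂ) : Heisenberg ω → ℂ := fun z =>
  ∫ x : X, F (z * Heisenberg.ofVec ω (x : T)) ∂μ

/-- `δ_X * F` for the left action: the average `z ↦ ∫_X F(x⁻¹ · z) dμ(x)`. -/
def convLeft (μ : Measure X) (F : Heisenberg ω → ℂ) : Heisenberg ω → ℂ := fun z =>
  ∫ x : X, F ((Heisenberg.ofVec ω (x : T))⁻¹ * z) ∂μ

/-- All the integrals defining `convRight μ F` converge absolutely. -/
def ConvRightConverges (μ : Measure X) (F : Heisenberg ω → ℂ) : Prop :=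
  ∀ z : Heisenberg ω, Integrable (fun x : X => F (z * Heisenberg.ofVec ω (x : T))) μ

/-- All the integrals defining `convLeft μ F` converge absolutely. -/
def ConvLeftConverges (μ : Measure X) (F : Heisenberg ω → ℂ) : Prop :=
  ∀ z : Heisenberg ω, Integrable (fun x : X => F ((Heisenberg.ofVec ω (x : T))⁻¹ * z)) μ

end Convolution

/-! ### The Maslov index -/

section Maslov

variable {T : Type*} [AddCommGroup T] [Module ℝ T]

/-- The Kashiwara form `κ(a, b, c) = ω(a, b) + ω(b, c) + ω(c, a)` on `A ⊕ B ⊕ C`. -/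
def kashiwaraForm (ω : LinearMap.BilinForm ℝ T) (A B C : Submodule ℝ T) :
    QuadraticForm ℝ (A × B × C) :=
  LinearMap.BilinMap.toQuadraticMap <|
    let pA : (A × B × C) →ₗ[ℝ] T := A.subtype ∘ₗ LinearMap.fst ℝ A (B × C)
    let pB : (A × B × C) →ₗ[ℝ] T :=
      B.subtype ∘ₗ LinearMap.fst ℝ B C ∘ₗ LinearMap.snd ℝ A (B × C)
    let pC : (A × B × C) →ₗ[ℝ] T :=
      C.subtype ∘ₗ LinearMap.snd ℝ B C ∘ₗ LinearMap.snd ℝ A (B × C)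
    ω.compl₁₂ pA pB + ω.compl₁₂ pB pC + ω.compl₁₂ pC pA

theorem kashiwaraForm_apply (ω : LinearMap.BilinForm ℝ T) (A B C : Submodule ℝ T)
    (a : A) (b : B) (c : C) :
    kashiwaraForm ω A B C (a, b, c) = ω (a : T) b + ω (b : T) c + ω (c : T) a := rfl

/-- The Maslov index of a triple: the number of positive minus the number of negative squares in
the Sylvester normal form of the Kashiwara form. -/
def maslovIndex [FiniteDimensional ℝ T] (ω : LinearMap.BilinForm ℝ T)
    (A B C : Submodule ℝ T) : ℤ :=
  (sigPos (kashiwaraForm ω A B C) : ℤ) - (sigNeg (kashiwaraForm ω A B C) : ℤ)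

end Maslov

/-! ### Liouville measure and Radon-Nikodym factors -/

section Measures

variable {T : Type*} [NormedAddCommGroup T] [NormedSpace ℝ T] [FiniteDimensional ℝ T]
  [MeasurableSpace T] [BorelSpace T]

/-- The measure `|det (ω(b i, b j))|^{1/2} · |db|` computed in a basis `b`, where `|db|` gives mass
one to the parallelepiped spanned by `b`. As `|det|^{1/2}` is the absolute value of the Pfaffian,
this is the measure of the volume form `ω^n / n!`; for a symplectic basis it is `|db|`. -/
def liouvilleOfBasis {ι : Type*} [Fintype ι] [DecidableEq ι] (ω : LinearMap.BilinForm ℝ T)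
    (b : Module.Basis ι ℝ T) : Measure T :=
  ENNReal.ofReal (Real.sqrt |(LinearMap.BilinForm.toMatrix b ω).det|) • b.addHaar

/-- The Liouville measure of a symplectic vector space. -/
def liouvilleMeasure (ω : LinearMap.BilinForm ℝ T) : Measure T :=
  liouvilleOfBasis ω (Module.finBasis ℝ T)

theorem liouvilleOfBasis_eq_of_basis {ι : Type*} [Fintype ι] [DecidableEq ι]
    (ω : LinearMap.BilinForm ℝ T) (b c : Module.Basis ι ℝ T) :
    liouvilleOfBasis ω b = liouvilleOfBasis ω c := by
  let f : T ≃ₗ[ℝ] T := b.equiv c (Equiv.refl ι)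
  have hbc : b.map f = c := by
    ext i
    simp [f]
  have hP : LinearMap.toMatrix b b (f : T →ₗ[ℝ] T) = b.toMatrix c := by
    ext i j
    simp [LinearMap.toMatrix_apply, Module.Basis.toMatrix_apply, f]
  have hdet : LinearMap.det (f : T →ₗ[ℝ] T) = (b.toMatrix c).det := by
    rw [← LinearMap.det_toMatrix b, hP]
  have hf0 : LinearMap.det (f : T →ₗ[ℝ] T) ≠ 0 := (LinearEquiv.isUnit_det' f).ne_zero
  have hmap : c.addHaar =
      ENNReal.ofReal |(LinearMap.det (f : T →ₗ[ℝ] T))⁻¹| • b.addHaar := by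
    rw [← Measure.map_linearMap_addHaar_eq_smul_addHaar b.addHaar hf0]
    have := b.map_addHaar f.toContinuousLinearEquiv
    have h2 : b.map (f.toContinuousLinearEquiv).toLinearEquiv = c := hbc
    rw [h2] at this
    exact this.symm
  have hG := LinearMap.BilinForm.toMatrix_mul_basis_toMatrix b c ω
  rw [liouvilleOfBasis, liouvilleOfBasis, hmap, smul_smul, ← hG, Matrix.det_mul, Matrix.det_mul,
    Matrix.det_transpose, ← hdet, ← ENNReal.ofReal_mul (Real.sqrt_nonneg _)]
  congr 2
  set d := LinearMap.det (f : T →ₗ[ℝ] T)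
  set m := (LinearMap.BilinForm.toMatrix b ω).det
  have h1 : |d * m * d| = |d| ^ 2 * |m| := by
    rw [abs_mul, abs_mul]; ring
  rw [h1, Real.sqrt_mul (by positivity), Real.sqrt_sq (abs_nonneg d), abs_inv]
  have : |d| ≠ 0 := abs_ne_zero.mpr hf0
  field_simp

/-- The Liouville measure does not depend on the basis used to compute it. -/
theorem liouvilleMeasure_eq_of_basis {ι : Type*} [Fintype ι] [DecidableEq ι]
    (ω : LinearMap.BilinForm ℝ T) (b : Module.Basis ι ℝ T) :
    liouvilleMeasure ω = liouvilleOfBasis ω b := by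
  let e : ι ≃ Fin (Module.finrank ℝ T) := b.indexEquiv (Module.finBasis ℝ T)
  rw [liouvilleMeasure, liouvilleOfBasis_eq_of_basis ω (Module.finBasis ℝ T) (b.reindex e),
    liouvilleOfBasis, liouvilleOfBasis, Module.Basis.addHaar_reindex]
  have hM : LinearMap.BilinForm.toMatrix (b.reindex e) ω =
      (LinearMap.BilinForm.toMatrix b ω).submatrix e.symm e.symm := by
    ext i j
    simp [LinearMap.BilinForm.toMatrix_apply]
  rw [hM, Matrix.det_submatrix_equiv_self]

/-- The value of a Radon-Nikodym derivative `dμ/dν` that is constant almost everywhere. -/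
def rnConst (μ ν : Measure T) : ℝ := (essSup (μ.rnDeriv ν) ν).toReal

/-- The product measure `μ × ν` on `T = X ⊕ Y`. -/
def sumMeasure {X Y : Submodule ℝ T} (μ : Measure X) (ν : Measure Y) : Measure T :=
  (μ.prod ν).map (fun p => (p.1 : T) + (p.2 : T))

/-- The constant Radon-Nikodym derivative `dμ dν / dL` of the product measure on `T = X ⊕ Y` with
respect to the Liouville measure of `ω`. -/
def rnFactor (ω : LinearMap.BilinForm ℝ T) {X Y : Submodule ℝ T}
    (μ : Measure X) (ν : Measure Y) : ℝ :=
  rnConst (sumMeasure μ ν) (liouvilleMeasure ω)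

/-- The derivative in `rnFactor` is indeed a constant. -/
theorem sumMeasure_eq_rnFactor_smul {ω : LinearMap.BilinForm ℝ T} (hω : ω.Nondegenerate)
    {X Y : Submodule ℝ T} (hXY : IsCompl X Y) (μ : Measure X) (ν : Measure Y)
    [μ.IsAddHaarMeasure] [ν.IsAddHaarMeasure] :
    0 < rnFactor ω μ ν ∧
      sumMeasure μ ν = ENNReal.ofReal (rnFactor ω μ ν) • liouvilleMeasure ω := by
  have hL : (liouvilleMeasure ω).IsAddHaarMeasure := by
    have hd : (LinearMap.BilinForm.toMatrix (Module.finBasis ℝ T) ω).det ≠ 0 :=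
      (LinearMap.BilinForm.nondegenerate_iff_det_ne_zero _).mp hω
    refine Measure.IsAddHaarMeasure.smul _ ?_ ENNReal.ofReal_ne_top
    rw [ENNReal.ofReal_ne_zero_iff]
    exact Real.sqrt_pos.mpr (abs_pos.mpr hd)
  have hS : (sumMeasure μ ν).IsAddHaarMeasure :=
    ((X.prodEquivOfIsCompl Y hXY).toContinuousLinearEquiv).isAddHaarMeasure_map (μ.prod ν)
  obtain hc := Measure.isAddLeftInvariant_eq_smul (sumMeasure μ ν) (liouvilleMeasure ω)
  set c := Measure.addHaarScalarFactor (sumMeasure μ ν) (liouvilleMeasure ω)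
  have hcpos : 0 < c := Measure.addHaarScalarFactor_pos_of_isAddHaarMeasure _ _
  have hval : rnFactor ω μ ν = c := by
    have h1 : (sumMeasure μ ν).rnDeriv (liouvilleMeasure ω)
        =ᵐ[liouvilleMeasure ω] fun _ => (c : ENNReal) := by
      rw [hc]
      filter_upwards [Measure.rnDeriv_smul_left' (liouvilleMeasure ω) (liouvilleMeasure ω) c,
        Measure.rnDeriv_self (liouvilleMeasure ω)] with x hx hx'
      rw [hx, Pi.smul_apply, hx', ENNReal.smul_def, smul_eq_mul, mul_one]
    rw [rnFactor, rnConst, essSup_congr_ae h1, essSup_const _ (NeZero.ne _), ENNReal.coe_toReal]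
  refine ⟨by rw [hval]; exact_mod_cast hcpos, ?_⟩
  rw [hval, ENNReal.ofReal_coe_nnreal]
  exact hc

end Measures

end

/-!
The three convolutions become classical Fourier analysis once coordinates are chosen well.

Since `C` is transversal to both `A` and `B`, it is the graph of an isomorphism `A ≃ B`, and
`(c, c') ↦ ω(Pc, Qc')` is a symmetric nondegenerate form on `C` (`graphForm`). Diagonalizing it
with entries `εᵢ = ±1` gives parametrizations of `A`, `B`, `C` by one Euclidean space in which
`C` is the diagonal of `A ⊕ B` and `ω(a, b) = ∑ εᵢ aᵢ bᵢ` (`exists_adapted_coordinates`). There the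
Kashiwara form is `∑ εᵢ (xᵢyᵢ - yᵢzᵢ - zᵢxᵢ)`, of signature `-∑ εᵢ` (`maslovIndex_eq_neg_sum`), and
any two of the parametrizations combine to a symplectic one up to signs, so that the
Radon-Nikodym factors are products of the scalars that relate the Haar measures to Lebesgue
measure (`rnFactor_smul_map_volume`).

In these coordinates `δ_A` is a Fourier transform, `δ_C` multiplies by the chirp
`exp(π i h ∑ εᵢ zᵢ²)` and transforms back, and `δ_B` is convolution with the same chirp
(`convRight_triple_coordinates`). The Fourier transform of a chirp is the inverse chirp times the
Fresnel constant `∏ |h|^{-1/2} exp(π i sgn(h εᵢ) / 4)`, so the last convolution cancels the chirp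
and Fourier inversion recovers `f`. As the chirp is not integrable, this is proved by inserting a
decaying Gaussian, applying Fubini and removing the Gaussian by dominated convergence
(`integral_chirp_mul_comp_sub`).

The left action is the right action conjugated by inversion in the Heisenberg group, which replaces
`h` by `-h` and `f` by its reflection (`indLeft_eq_indRight_inv`, `convLeft_eq_convRight_inv`).
-/

noncomputable section

/-! ### The unitary character -/

theorem eChar_add (s t : ℝ) : eChar (s + t) = eChar s * eChar t := by
  simp only [eChar, ← Complex.exp_add]
  push_cast
  ring_nf

theorem eChar_zero : eChar 0 = 1 := by simp [eChar]

theorem eChar_eq_cexp_mul_I (t : ℝ) :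
    eChar t = Complex.exp (((Real.pi * t : ℝ) : ℂ) * Complex.I) := by
  rw [eChar]
  push_cast
  ring_nf

theorem norm_eChar (t : ℝ) : ‖eChar t‖ = 1 := by
  rw [eChar_eq_cexp_mul_I, Complex.norm_exp_ofReal_mul_I]

@[fun_prop]
theorem continuous_eChar : Continuous eChar := by
  unfold eChar
  fun_prop

theorem eChar_sum {ι : Type*} (s : Finset ι) (f : ι → ℝ) :
    eChar (∑ i ∈ s, f i) = ∏ i ∈ s, eChar (f i) := by
  simp only [eChar, ← Complex.exp_sum, Complex.ofReal_sum, Finset.mul_sum]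

theorem iteratedDeriv_eChar (n : ℕ) :
    iteratedDeriv n eChar = fun t => (Real.pi * Complex.I) ^ n * eChar t := by
  induction n with
  | zero => simp
  | succ n ih =>
    rw [iteratedDeriv_succ, ih]
    funext t
    have h : HasDerivAt eChar (Real.pi * Complex.I * eChar t) t := by
      have h1 : HasDerivAt (fun s : ℝ => (Real.pi * Complex.I * s : ℂ))
          (Real.pi * Complex.I) t := by
        simpa using (Complex.ofRealCLM.hasDerivAt (x := t)).const_mul (Real.pi * Complex.I : ℂ)
      exact h1.cexp.congr_deriv (by rw [eChar, mul_comm])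
    rw [(h.const_mul _).deriv]
    ring

theorem hasTemperateGrowth_eChar : Function.HasTemperateGrowth eChar := by
  refine ⟨?_, fun n => ⟨0, Real.pi ^ n, fun t => ?_⟩⟩
  · exact (contDiff_const.mul Complex.ofRealCLM.contDiff).cexp
  · rw [norm_iteratedFDeriv_eq_norm_iteratedDeriv, iteratedDeriv_eChar]
    simp [norm_eChar, abs_of_pos Real.pi_pos]

/-! ### Diagonal bilinear forms and the Fourier transform -/

section Diagonal

variable {ι : Type*} [Fintype ι]

/-- The diagonal symmetric bilinear form `∑ᵢ dᵢ pᵢ qᵢ` on Euclidean space. -/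
def diagForm (d : ι → ℝ) (p q : EuclideanSpace ℝ ι) : ℝ := ∑ i, d i * p i * q i

variable (d : ι → ℝ) (p q r : EuclideanSpace ℝ ι)

theorem diagForm_comm : diagForm d p q = diagForm d q p :=
  Finset.sum_congr rfl fun i _ => by ring

theorem diagForm_add_left : diagForm d (p + q) r = diagForm d p r + diagForm d q r := by
  simp only [diagForm, ← Finset.sum_add_distrib, PiLp.add_apply]
  exact Finset.sum_congr rfl fun i _ => by ring

theorem diagForm_sub_left : diagForm d (p - q) r = diagForm d p r - diagForm d q r := by
  simp only [diagForm, ← Finset.sum_sub_distrib, PiLp.sub_apply]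
  exact Finset.sum_congr rfl fun i _ => by ring

theorem diagForm_add_right : diagForm d p (q + r) = diagForm d p q + diagForm d p r := by
  rw [diagForm_comm, diagForm_add_left, diagForm_comm d q, diagForm_comm d r]

theorem diagForm_neg_weight : diagForm (-d) p q = -diagForm d p q := by
  simp only [diagForm, ← Finset.sum_neg_distrib, Pi.neg_apply]
  exact Finset.sum_congr rfl fun i _ => by ring

theorem diagForm_smul_weight (c : ℝ) : diagForm (c • d) p q = c * diagForm d p q := by
  simp only [diagForm, Finset.mul_sum, Pi.smul_apply, smul_eq_mul]
  exact Finset.sum_congr rfl fun i _ => by ring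

theorem diagForm_zero_right : diagForm d p 0 = 0 := by simp [diagForm]

@[fun_prop]
theorem Continuous.diagForm {X : Type*} [TopologicalSpace X] {f g : X → EuclideanSpace ℝ ι}
    (hf : Continuous f) (hg : Continuous g) : Continuous fun x => diagForm d (f x) (g x) := by
  unfold _root_.diagForm
  fun_prop

theorem hasTemperateGrowth_eChar_diagForm :
    Function.HasTemperateGrowth fun z : EuclideanSpace ℝ ι => eChar (diagForm d z z) := by
  refine hasTemperateGrowth_eChar.comp (f := fun z => diagForm d z z) ?_
  refine Function.HasTemperateGrowth.sum fun i _ => ?_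
  have h : Function.HasTemperateGrowth fun z : EuclideanSpace ℝ ι => z i :=
    (EuclideanSpace.proj (𝕜 := ℝ) i).hasTemperateGrowth
  exact ((Function.HasTemperateGrowth.const (d i)).mul h).mul h

variable {d}

/-- The diagonal map `z ↦ (dᵢ zᵢ)ᵢ`, for nonzero `dᵢ`. -/
def diagEquiv (hd : ∀ i, d i ≠ 0) : EuclideanSpace ℝ ι ≃ₗ[ℝ] EuclideanSpace ℝ ι where
  toFun z := WithLp.toLp 2 fun i => d i * z i
  invFun z := WithLp.toLp 2 fun i => (d i)⁻¹ * z i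
  map_add' x y := by ext i; simp [mul_add]
  map_smul' c x := by ext i; simp; ring
  left_inv x := by ext i; simp [hd i]
  right_inv x := by ext i; simp [hd i]

theorem inner_diagEquiv (hd : ∀ i, d i ≠ 0) :
    inner ℝ p (diagEquiv hd q) = diagForm d p q := by
  simp only [PiLp.inner_apply, diagForm, diagEquiv, LinearEquiv.coe_mk, LinearMap.coe_mk,
    AddHom.coe_mk, RCLike.inner_apply, conj_trivial]
  exact Finset.sum_congr rfl fun i _ => by ring

theorem det_diagEquiv (hd : ∀ i, d i ≠ 0) :
    LinearMap.det (diagEquiv hd : EuclideanSpace ℝ ι →ₗ[ℝ] EuclideanSpace ℝ ι) = ∏ i, d i := by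
  classical
  rw [← LinearMap.det_toMatrix (EuclideanSpace.basisFun ι ℝ).toBasis]
  have : LinearMap.toMatrix (EuclideanSpace.basisFun ι ℝ).toBasis
      (EuclideanSpace.basisFun ι ℝ).toBasis
      (diagEquiv hd : EuclideanSpace ℝ ι →ₗ[ℝ] EuclideanSpace ℝ ι) = Matrix.diagonal d := by
    ext i j
    simp [LinearMap.toMatrix_apply, diagEquiv, Matrix.diagonal_apply]
  rw [this, Matrix.det_diagonal]

open FourierTransform in
/-- The Fourier transform in which `diagForm d` replaces the inner product preserves Schwartz
functions. -/
theorem exists_schwartzMap_eq_integral_diagForm (hd : ∀ i, d i ≠ 0)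
    (u : 𝓢(EuclideanSpace ℝ ι, ℂ)) :
    ∃ G : 𝓢(EuclideanSpace ℝ ι, ℂ), ∀ z, G z = ∫ x, eChar (-(2 * diagForm d x z)) * u x := by
  refine ⟨SchwartzMap.compCLMOfContinuousLinearEquiv ℂ (diagEquiv hd).toContinuousLinearEquiv (𝓕 u),
    fun z => ?_⟩
  rw [SchwartzMap.compCLMOfContinuousLinearEquiv_apply, Function.comp_apply,
    SchwartzMap.fourier_coe, Real.fourier_eq']
  refine integral_congr_ae (Filter.Eventually.of_forall fun x => ?_)
  simp only [LinearEquiv.coe_toContinuousLinearEquiv', inner_diagEquiv, smul_eq_mul, eChar]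
  push_cast
  ring_nf

open FourierTransform in
/-- Fourier inversion for the transform in which `diagForm d` replaces the inner product. -/
theorem integral_eChar_diagForm_mul_of_eq_integral (hd : ∀ i, d i ≠ 0)
    (u : 𝓢(EuclideanSpace ℝ ι, ℂ)) (G : EuclideanSpace ℝ ι → ℂ)
    (hG : ∀ z, G z = ∫ x, eChar (-(2 * diagForm d x z)) * u x) (x : EuclideanSpace ℝ ι) :
    ∫ z, eChar (2 * diagForm d x z) * G z = ((∏ i, |d i|)⁻¹ : ℝ) * u x := by
  have hGu : ∀ z, G z = (𝓕 u) (diagEquiv hd z) := fun z => by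
    rw [hG, SchwartzMap.fourier_coe, Real.fourier_eq']
    refine integral_congr_ae (Filter.Eventually.of_forall fun x => ?_)
    simp only [inner_diagEquiv, smul_eq_mul, eChar]
    push_cast
    ring_nf
  have hinv : 𝓕⁻ (𝓕 u) = u := FourierTransform.fourierInv_fourier_eq u
  have hux : u x = ∫ w, Complex.exp (((2 * Real.pi * inner ℝ w x : ℝ) : ℂ) * Complex.I) •
      (𝓕 u) w := by
    conv_lhs => rw [← hinv, SchwartzMap.fourierInv_coe, Real.fourierInv_eq']
  have hdet : LinearMap.det (diagEquiv hd : EuclideanSpace ℝ ι →ₗ[ℝ] EuclideanSpace ℝ ι) ≠ 0 := by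
    rw [det_diagEquiv]
    exact Finset.prod_ne_zero_iff.mpr fun i _ => hd i
  have hmap := Measure.map_linearMap_addHaar_eq_smul_addHaar
    (volume : Measure (EuclideanSpace ℝ ι)) hdet
  have hme : MeasurableEmbedding (diagEquiv hd) :=
    (diagEquiv hd).toContinuousLinearEquiv.toHomeomorph.measurableEmbedding
  have hcv := hme.integral_map (μ := volume) fun w =>
    Complex.exp (((2 * Real.pi * inner ℝ w x : ℝ) : ℂ) * Complex.I) • (𝓕 u) w
  rw [LinearEquiv.coe_coe] at hmap
  rw [hmap, integral_smul_measure, ← hux, det_diagEquiv, abs_inv, Finset.abs_prod,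
    ENNReal.toReal_ofReal (by positivity), Complex.real_smul] at hcv
  rw [hcv]
  refine integral_congr_ae (Filter.Eventually.of_forall fun z => ?_)
  simp only [hGu, real_inner_comm, inner_diagEquiv, smul_eq_mul, eChar]
  push_cast
  ring_nf

end Diagonal

/-! ### Convolution with an imaginary Gaussian -/

section Chirp

open Filter Topology

/-- The principal square root of `i / d`, which carries the Fresnel phase `exp(π i sgn(d) / 4)`:
it is the limit of the normalization of a decaying Gaussian. -/
theorem one_div_neg_I_mul_cpow_half {d : ℝ} (hd : d ≠ 0) :
    (1 / (-(d * Complex.I)) : ℂ) ^ (1 / 2 : ℂ) =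
      ((|d| ^ (-(1 / 2) : ℝ) : ℝ) : ℂ) * eChar (Real.sign d / 4) := by
  have h1 : (1 / (-(d * Complex.I)) : ℂ) =
      ((|d|⁻¹ : ℝ) : ℂ) * Complex.exp (((Real.sign d * (Real.pi / 2) : ℝ) : ℂ) * Complex.I) := by
    have hI : Complex.I ≠ 0 := Complex.I_ne_zero
    have hdc : (d : ℂ) ≠ 0 := by exact_mod_cast hd
    rcases lt_or_gt_of_ne hd with h | h
    · rw [abs_of_neg h, Real.sign_of_neg h]
      have : Complex.exp (((-1 * (Real.pi / 2) : ℝ) : ℂ) * Complex.I) = -Complex.I := by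
        push_cast
        rw [show (-1 * (Real.pi / 2) : ℂ) * Complex.I = -(Real.pi / 2 * Complex.I) by ring,
          Complex.exp_neg, Complex.exp_pi_div_two_mul_I, Complex.inv_I]
      rw [this]
      push_cast
      field_simp
      simp
    · rw [abs_of_pos h, Real.sign_of_pos h]
      have : Complex.exp (((1 * (Real.pi / 2) : ℝ) : ℂ) * Complex.I) = Complex.I := by
        push_cast
        rw [one_mul, Complex.exp_pi_div_two_mul_I]
      rw [this]
      push_cast
      field_simp
      simp
  have habs : 0 < |d|⁻¹ := inv_pos.mpr (abs_pos.mpr hd)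
  have hs : |Real.sign d| = 1 := by
    rcases Real.sign_apply_eq_of_ne_zero d hd with h | h <;> simp [h]
  have hs' := abs_le.mp hs.le
  rw [h1, Complex.cpow_def_of_ne_zero
    (mul_ne_zero (by exact_mod_cast habs.ne') (Complex.exp_ne_zero _)),
    Complex.log_ofReal_mul habs (Complex.exp_ne_zero _), Complex.log_exp, add_mul,
    Complex.exp_add]
  · congr 1
    · rw [Real.rpow_def_of_pos (abs_pos.mpr hd), Real.log_inv]
      push_cast
      ring_nf
    · rw [eChar]
      push_cast
      ring_nf
  · rw [Complex.im_ofReal_mul, Complex.I_im]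
    nlinarith [Real.pi_pos]
  · rw [Complex.im_ofReal_mul, Complex.I_im]
    nlinarith [Real.pi_pos]

/-- The Fourier transform of the imaginary Gaussian `eChar (diagForm d y y)` regularized by a
decaying Gaussian, as an explicit product. -/
theorem integral_regularized_chirp {ι : Type*} [Fintype ι] (d : ι → ℝ) {δ : ℝ} (hδ : 0 < δ)
    (z : EuclideanSpace ℝ ι) :
    ∫ y, (Real.exp (-(Real.pi * δ) * ‖y‖ ^ 2) : ℂ) *
        (eChar (diagForm d y y) * eChar (-(2 * diagForm d y z))) =
      ∏ i, ((1 / (δ - d i * Complex.I) : ℂ) ^ (1 / 2 : ℂ) *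
        Complex.exp (-(Real.pi * (d i * z i) ^ 2 / (δ - d i * Complex.I)))) := by
  have hb : ∀ i, 0 < (Real.pi * (δ - d i * Complex.I) : ℂ).re := fun i => by
    simp [Real.pi_pos, hδ]
  have h := GaussianFourier.integral_cexp_neg_sum_mul_add hb
    (fun i => -(2 * Real.pi * Complex.I * d i * z i))
  rw [← (EuclideanSpace.volume_preserving_symm_measurableEquiv_toLp ι).symm.integral_comp'] 
  refine Eq.trans ?_ (h.trans ?_)
  · refine integral_congr_ae (Eventually.of_forall fun v => ?_)
    simp only [eChar, diagForm, EuclideanSpace.norm_sq_eq]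
    push_cast
    rw [← Complex.exp_add, ← Complex.exp_add]
    congr 1
    simp only [MeasurableEquiv.symm_symm, MeasurableEquiv.coe_toLp, Real.norm_eq_abs]
    simp only [← Complex.ofReal_pow, sq_abs, Finset.mul_sum, ← Finset.sum_neg_distrib,
      ← Finset.sum_add_distrib]
    refine Finset.sum_congr rfl fun i _ => ?_
    push_cast
    ring
  · refine Finset.prod_congr rfl fun i _ => ?_
    have hne : (δ - d i * Complex.I : ℂ) ≠ 0 := fun h0 => by
      have := congrArg Complex.re h0
      simp at this
      exact hδ.ne' this
    have hpi : (Real.pi : ℂ) ≠ 0 := by exact_mod_cast Real.pi_ne_zero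
    congr 2
    · field_simp
    · field_simp
      rw [Complex.I_sq]
      ring

/-- The regularized Fourier transform of the chirp is bounded uniformly in the regularization. -/
theorem norm_regularized_chirp_factor_le {d : ℝ} (hd : d ≠ 0) {δ : ℝ} (hδ : 0 < δ) (t : ℝ) :
    ‖(1 / (δ - d * Complex.I) : ℂ) ^ (1 / 2 : ℂ) *
        Complex.exp (-(Real.pi * (d * t) ^ 2 / (δ - d * Complex.I)))‖ ≤
      |d| ^ (-(1 / 2) : ℝ) := by
  have hre : (δ - d * Complex.I : ℂ).re = δ := by simp
  have hne : (δ - d * Complex.I : ℂ) ≠ 0 := fun h0 => by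
    rw [h0] at hre
    exact hδ.ne hre
  have hd' : 0 < |d| := abs_pos.mpr hd
  have hnorm : |d| ≤ ‖(δ - d * Complex.I : ℂ)‖ := by
    simpa using Complex.abs_im_le_norm (δ - d * Complex.I : ℂ)
  rw [norm_mul]
  refine (mul_le_of_le_one_right (norm_nonneg _) ?_).trans ?_
  -- `(δ - i d)⁻¹` has nonnegative real part, so the exponential has norm at most `1`.
  · rw [Complex.norm_exp, Real.exp_le_one_iff, Complex.neg_re, neg_nonpos,
      show (Real.pi * (d * t) ^ 2 : ℂ) = ((Real.pi * (d * t) ^ 2 : ℝ) : ℂ) by push_cast; rfl,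
      div_eq_mul_inv, Complex.re_ofReal_mul, Complex.inv_re, hre]
    have := Complex.normSq_nonneg (δ - d * Complex.I : ℂ)
    have := Real.pi_pos
    positivity
  · have h2 : ((1 / 2 : ℂ)) = ((1 / 2 : ℝ) : ℂ) := by push_cast; rfl
    rw [h2, Complex.norm_cpow_real, norm_div, norm_one, one_div, Real.inv_rpow (norm_nonneg _),
      ← Real.rpow_neg (norm_nonneg _)]
    exact Real.rpow_le_rpow_of_nonpos hd' hnorm (by norm_num)

/-- The regularized Fourier transform of the chirp converges to a constant multiple of the
inverse chirp. -/
theorem tendsto_regularized_chirp_factor {d : ℝ} (hd : d ≠ 0) (t : ℝ) :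
    Tendsto (fun δ : ℝ => (1 / (δ - d * Complex.I) : ℂ) ^ (1 / 2 : ℂ) *
        Complex.exp (-(Real.pi * (d * t) ^ 2 / (δ - d * Complex.I)))) (𝓝[>] 0)
      (𝓝 (((|d| ^ (-(1 / 2) : ℝ) : ℝ) : ℂ) * eChar (Real.sign d / 4) * eChar (-(d * t * t)))) := by
  have hdc : (d : ℂ) ≠ 0 := by exact_mod_cast hd
  have hI : Complex.I ≠ 0 := Complex.I_ne_zero
  have h0 : ((0 : ℝ) - d * Complex.I : ℂ) ≠ 0 := by simp [hd]
  have hlim : (1 / ((0 : ℝ) - d * Complex.I) : ℂ) ^ (1 / 2 : ℂ) *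
      Complex.exp (-(Real.pi * (d * t) ^ 2 / ((0 : ℝ) - d * Complex.I))) =
      ((|d| ^ (-(1 / 2) : ℝ) : ℝ) : ℂ) * eChar (Real.sign d / 4) * eChar (-(d * t * t)) := by
    rw [Complex.ofReal_zero, zero_sub, one_div_neg_I_mul_cpow_half hd, eChar.eq_1 (-(d * t * t))]
    congr 2
    push_cast
    field_simp
    rw [Complex.I_sq]
    ring
  rw [← hlim]
  have hcont : ContinuousAt (fun δ : ℝ => (1 / (δ - d * Complex.I) : ℂ)) 0 :=
    ContinuousAt.div continuousAt_const (by fun_prop) h0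
  have hcont2 : ContinuousAt (fun δ : ℝ =>
      Complex.exp (-(Real.pi * (d * t) ^ 2 / (δ - d * Complex.I)))) 0 := by
    have : ContinuousAt (fun δ : ℝ => (Real.pi * (d * t) ^ 2 / (δ - d * Complex.I) : ℂ)) 0 :=
      ContinuousAt.div continuousAt_const (by fun_prop) h0
    exact this.neg.cexp
  -- The limit `i / d` is off the branch cut, so the principal square root is continuous there.
  have hslit : (1 / ((0 : ℝ) - d * Complex.I) : ℂ) ∈ Complex.slitPlane := by
    refine Or.inr ?_
    simp [Complex.inv_im, hd]
  exact ((hcont.cpow continuousAt_const hslit).mul hcont2).tendsto.mono_left nhdsWithin_le_nhds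

variable {ι : Type*} [Fintype ι]

/-- Fubini for the regularized convolution: the chirp is absolutely integrable only after it has
been multiplied by a decaying Gaussian. -/
theorem integral_regularized_chirp_mul_comp_sub (d : ι → ℝ) {k : EuclideanSpace ℝ ι → ℂ}
    (hk : Integrable k) {δ : ℝ} (hδ : 0 < δ) (x : EuclideanSpace ℝ ι) :
    ∫ y, (Real.exp (-(Real.pi * δ) * ‖y‖ ^ 2) : ℂ) *
        (eChar (diagForm d y y) * ∫ z, eChar (2 * diagForm d (x - y) z) * k z) =
      ∫ z, eChar (2 * diagForm d x z) * k z *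
        ∏ i, ((1 / (δ - d i * Complex.I) : ℂ) ^ (1 / 2 : ℂ) *
          Complex.exp (-(Real.pi * (d i * z i) ^ 2 / (δ - d i * Complex.I)))) := by
  have hgauss : Integrable fun y : EuclideanSpace ℝ ι =>
      (Real.exp (-(Real.pi * δ) * ‖y‖ ^ 2) : ℂ) := by
    have := GaussianFourier.integrable_cexp_neg_mul_sq_norm_add (V := EuclideanSpace ℝ ι)
      (b := ((Real.pi * δ : ℝ) : ℂ)) (by simpa using mul_pos Real.pi_pos hδ) 0 0
    simpa using this
  have hint : Integrable (Function.uncurry fun y z : EuclideanSpace ℝ ι =>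
      eChar (diagForm d y y) * eChar (2 * diagForm d (x - y) z) *
        ((Real.exp (-(Real.pi * δ) * ‖y‖ ^ 2) : ℂ) * k z))
      ((volume : Measure (EuclideanSpace ℝ ι)).prod volume) := by
    refine (hgauss.mul_prod hk).bdd_mul (c := 1) ?_ ?_
    · refine Continuous.aestronglyMeasurable ?_
      fun_prop
    · exact Eventually.of_forall fun p => by simp [norm_eChar]
  calc _ = ∫ y, ∫ z, eChar (diagForm d y y) * eChar (2 * diagForm d (x - y) z) *
        ((Real.exp (-(Real.pi * δ) * ‖y‖ ^ 2) : ℂ) * k z) := by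
        refine integral_congr_ae (Eventually.of_forall fun y => ?_)
        simp only
        rw [← integral_const_mul, ← integral_const_mul]
        refine integral_congr_ae (Eventually.of_forall fun z => ?_)
        ring
    _ = _ := by
        rw [integral_integral_swap hint]
        refine integral_congr_ae (Eventually.of_forall fun z => ?_)
        simp only
        rw [← integral_regularized_chirp d hδ z, ← integral_const_mul]
        refine integral_congr_ae (Eventually.of_forall fun y => ?_)
        simp only
        rw [diagForm_sub_left, mul_sub, sub_eq_add_neg, eChar_add]
        ring

/-- Convolution with a chirp undoes, up to a constant, multiplication of the Fourier transform by
the same chirp: the Fourier transform of a chirp is a constant multiple of the inverse chirp.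
The constant carries the phase of the Fresnel integrals. -/
theorem integral_chirp_mul_comp_sub {d : ι → ℝ} (hd : ∀ i, d i ≠ 0)
    {G ψ : EuclideanSpace ℝ ι → ℂ} (hG : Integrable G) (hψi : Integrable ψ)
    (hψ : ∀ x, ψ x = ∫ z, eChar (2 * diagForm d x z) * (eChar (diagForm d z z) * G z))
    (x : EuclideanSpace ℝ ι) :
    ∫ y, eChar (diagForm d y y) * ψ (x - y) =
      (∏ i, ((|d i| ^ (-(1 / 2) : ℝ) : ℝ) : ℂ) * eChar (Real.sign (d i) / 4)) *
        ∫ z, eChar (2 * diagForm d x z) * G z := by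
  have hψx : Integrable fun y => ψ (x - y) := hψi.comp_sub_left x
  have hcψ : Integrable fun y => eChar (diagForm d y y) * ψ (x - y) :=
    hψx.bdd_mul (c := 1) (Continuous.aestronglyMeasurable (by fun_prop))
      (Eventually.of_forall fun y => (norm_eChar _).le)
  have hk : Integrable fun z => eChar (diagForm d z z) * G z :=
    hG.bdd_mul (c := 1) (Continuous.aestronglyMeasurable (by fun_prop))
      (Eventually.of_forall fun y => (norm_eChar _).le)
  -- Both sides of the regularized identity converge as `δ → 0⁺`; on the left the integrand is
  -- dominated by `|ψ (x - y)|`, on the right by a multiple of `|G|`.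
  have hL : Tendsto (fun δ : ℝ => ∫ y, (Real.exp (-(Real.pi * δ) * ‖y‖ ^ 2) : ℂ) *
      (eChar (diagForm d y y) * ψ (x - y))) (𝓝[>] 0)
      (𝓝 (∫ y, eChar (diagForm d y y) * ψ (x - y))) := by
    refine tendsto_integral_filter_of_dominated_convergence
      (fun y => ‖eChar (diagForm d y y) * ψ (x - y)‖) ?_ ?_ hcψ.norm ?_
    · exact Eventually.of_forall fun δ =>
        (Continuous.aestronglyMeasurable (by fun_prop)).mul hcψ.aestronglyMeasurable
    · filter_upwards [self_mem_nhdsWithin] with δ hδ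
      refine Eventually.of_forall fun y => ?_
      rw [norm_mul]
      refine mul_le_of_le_one_left (norm_nonneg _) ?_
      rw [Complex.norm_real, Real.norm_eq_abs, Real.abs_exp,
        Real.exp_le_one_iff]
      have : 0 ≤ Real.pi * δ * ‖y‖ ^ 2 := by
        have : (0 : ℝ) < δ := hδ
        have := Real.pi_pos
        positivity
      linarith
    · refine Eventually.of_forall fun y => ?_
      have hc : Continuous fun δ : ℝ => (Real.exp (-(Real.pi * δ) * ‖y‖ ^ 2) : ℂ) *
          (eChar (diagForm d y y) * ψ (x - y)) := by fun_prop
      have := (hc.tendsto 0).mono_left (nhdsWithin_le_nhds (s := Set.Ioi (0 : ℝ)))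
      simpa using this
  have hR : Tendsto (fun δ : ℝ => ∫ z, eChar (2 * diagForm d x z) *
      (eChar (diagForm d z z) * G z) *
        ∏ i, ((1 / (δ - d i * Complex.I) : ℂ) ^ (1 / 2 : ℂ) *
          Complex.exp (-(Real.pi * (d i * z i) ^ 2 / (δ - d i * Complex.I))))) (𝓝[>] 0)
      (𝓝 (∫ z, eChar (2 * diagForm d x z) * (eChar (diagForm d z z) * G z) *
        ∏ i, (((|d i| ^ (-(1 / 2) : ℝ) : ℝ) : ℂ) * eChar (Real.sign (d i) / 4) *
          eChar (-(d i * z i * z i))))) := by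
    refine tendsto_integral_filter_of_dominated_convergence
      (fun z => ‖G z‖ * ∏ i, |d i| ^ (-(1 / 2) : ℝ)) ?_ ?_ (hG.norm.mul_const _) ?_
    · refine Eventually.of_forall fun δ => ?_
      refine ((Continuous.aestronglyMeasurable (by fun_prop)).mul
        hk.aestronglyMeasurable).mul (Continuous.aestronglyMeasurable ?_)
      fun_prop
    · filter_upwards [self_mem_nhdsWithin] with δ hδ
      refine Eventually.of_forall fun z => ?_
      rw [norm_mul, norm_mul, norm_mul, norm_eChar, norm_eChar, one_mul, one_mul, norm_prod]
      gcongr with i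
      exact norm_regularized_chirp_factor_le (hd i) hδ (z i)
    · refine Eventually.of_forall fun z => Tendsto.const_mul _ ?_
      exact tendsto_finsetProd _ fun i _ => tendsto_regularized_chirp_factor (hd i) (z i)
  have heq : (fun δ : ℝ => ∫ y, (Real.exp (-(Real.pi * δ) * ‖y‖ ^ 2) : ℂ) *
      (eChar (diagForm d y y) * ψ (x - y))) =ᶠ[𝓝[>] 0] fun δ : ℝ =>
      ∫ z, eChar (2 * diagForm d x z) * (eChar (diagForm d z z) * G z) *
        ∏ i, ((1 / (δ - d i * Complex.I) : ℂ) ^ (1 / 2 : ℂ) *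
          Complex.exp (-(Real.pi * (d i * z i) ^ 2 / (δ - d i * Complex.I)))) := by
    filter_upwards [self_mem_nhdsWithin] with δ hδ
    rw [← integral_regularized_chirp_mul_comp_sub d hk hδ x]
    simp only [hψ]
  rw [tendsto_nhds_unique (hL.congr' heq) hR, ← integral_const_mul]
  refine integral_congr_ae (Eventually.of_forall fun z => ?_)
  simp only
  rw [Finset.prod_mul_distrib, ← eChar_sum, Finset.sum_neg_distrib]
  -- The limit of the Gaussian transform is the inverse chirp.
  have h1 : eChar (diagForm d z z) * eChar (-∑ i, d i * z i * z i) = 1 := by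
    rw [← eChar_add, diagForm, add_neg_cancel, eChar_zero]
  linear_combination (∏ i, ((|d i| ^ (-(1 / 2) : ℝ) : ℝ) : ℂ) * eChar (Real.sign (d i) / 4)) *
    eChar (2 * diagForm d x z) * G z * h1

end Chirp

/-! ### Coordinates adapted to three Lagrangian subspaces -/

section Coordinates

variable {T : Type*} [AddCommGroup T] [Module ℝ T] {ω : LinearMap.BilinForm ℝ T}

theorem IsLagrangian.apply_eq_zero {X : Submodule ℝ T} (hX : IsLagrangian ω X) (x y : X) :
    ω (x : T) (y : T) = 0 :=
  (hX x).mp x.2 y y.2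

theorem projectionOnto_coe_add_left {X Y : Submodule ℝ T} (hXY : IsCompl X Y) (x : X) (y : Y) :
    X.projectionOnto Y hXY ((x : T) + y) = x := by
  rw [map_add, Submodule.projectionOnto_apply_left, Submodule.projectionOnto_apply_right, add_zero]

theorem projectionOnto_coe_add_right {X Y : Submodule ℝ T} (hXY : IsCompl X Y) (x : X) (y : Y) :
    Y.projectionOnto X hXY.symm ((x : T) + y) = y := by
  rw [add_comm, projectionOnto_coe_add_left]

theorem projectionOnto_add_projectionOnto {X Y : Submodule ℝ T} (hXY : IsCompl X Y) (t : T) :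
    (X.projectionOnto Y hXY t : T) + Y.projectionOnto X hXY.symm t = t := by
  rw [Submodule.coe_projectionOnto_apply, Submodule.coe_projectionOnto_apply,
    Submodule.projection_add_projection_eq_self]

theorem finrank_eq_of_isCompl_of_isCompl [FiniteDimensional ℝ T] {X Y Z : Submodule ℝ T}
    (hXZ : IsCompl X Z) (hYZ : IsCompl Y Z) : Module.finrank ℝ X = Module.finrank ℝ Y := by
  have h1 := Submodule.finrank_add_eq_of_isCompl hXZ
  have h2 := Submodule.finrank_add_eq_of_isCompl hYZ
  omega

/-- The symmetric bilinear form `(c, c') ↦ ω(Pc, Qc')` on `C`, for `P` and `Q` the projections of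
`A ⊕ B` onto its summands. -/
def graphForm (ω : LinearMap.BilinForm ℝ T) {A B : Submodule ℝ T} (hAB : IsCompl A B)
    (C : Submodule ℝ T) : LinearMap.BilinForm ℝ C :=
  ω.compl₁₂ (A.subtype ∘ₗ A.projectionOnto B hAB ∘ₗ C.subtype)
    (B.subtype ∘ₗ B.projectionOnto A hAB.symm ∘ₗ C.subtype)

theorem graphForm_apply {A B : Submodule ℝ T} (hAB : IsCompl A B) {C : Submodule ℝ T} (c c' : C) :
    graphForm ω hAB C c c' = ω (A.projectionOnto B hAB c : T) (B.projectionOnto A hAB.symm c') :=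
  rfl

theorem graphForm_comm (hω : ω.IsAlt) {A B C : Submodule ℝ T} (hA : IsLagrangian ω A)
    (hB : IsLagrangian ω B) (hC : IsLagrangian ω C) (hAB : IsCompl A B) (c c' : C) :
    graphForm ω hAB C c c' = graphForm ω hAB C c' c := by
  have h := hC.apply_eq_zero c c'
  rw [← projectionOnto_add_projectionOnto hAB (c : T),
    ← projectionOnto_add_projectionOnto hAB (c' : T)] at h
  simp only [map_add, LinearMap.add_apply, hA.apply_eq_zero, hB.apply_eq_zero] at h
  have h2 := hω.neg_eq (B.projectionOnto A hAB.symm c : T) (A.projectionOnto B hAB c' : T)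
  rw [graphForm_apply, graphForm_apply]
  linarith

/-- Three pairwise complementary Lagrangian subspaces have parametrizations in which `C` is the
diagonal of `A ⊕ B` and the pairing of `A` with `B` is diagonal with entries `±1`. -/
theorem exists_adapted_coordinates [FiniteDimensional ℝ T] {n : ℕ}
    (hn : Module.finrank ℝ T = 2 * n) (hω : ω.IsAlt) {A B C : Submodule ℝ T}
    (hA : IsLagrangian ω A) (hB : IsLagrangian ω B) (hC : IsLagrangian ω C)
    (hAB : IsCompl A B) (hBC : IsCompl B C) (hCA : IsCompl C A) :
    ∃ (ε : Fin n → ℝ) (eA : EuclideanSpace ℝ (Fin n) ≃ₗ[ℝ] A)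
      (eB : EuclideanSpace ℝ (Fin n) ≃ₗ[ℝ] B) (eC : EuclideanSpace ℝ (Fin n) ≃ₗ[ℝ] C),
      (∀ i, ε i = -1 ∨ ε i = 1) ∧ (∀ z, (eC z : T) = eA z + eB z) ∧
      ∀ p q, ω (eA p : T) (eB q) = diagForm ε p q := by
  have hfAC := finrank_eq_of_isCompl_of_isCompl hAB hBC.symm
  have hfBC := finrank_eq_of_isCompl_of_isCompl hAB.symm hCA
  have hfC : Module.finrank ℝ C = n := by
    have := Submodule.finrank_add_eq_of_isCompl hAB
    omega
  subst hfC
  have hPinj : Function.Injective (A.projectionOnto B hAB ∘ₗ C.subtype) := by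
    rw [← LinearMap.ker_eq_bot, LinearMap.ker_eq_bot']
    intro c hc
    have hcB : (c : T) ∈ B := (Submodule.projectionOnto_apply_eq_zero_iff hAB).mp hc
    exact Subtype.ext ((Submodule.disjoint_def.mp hBC.disjoint) c hcB c.2)
  have hQinj : Function.Injective (B.projectionOnto A hAB.symm ∘ₗ C.subtype) := by
    rw [← LinearMap.ker_eq_bot, LinearMap.ker_eq_bot']
    intro c hc
    have hcA : (c : T) ∈ A := (Submodule.projectionOnto_apply_eq_zero_iff hAB.symm).mp hc
    exact Subtype.ext ((Submodule.disjoint_def.mp hCA.disjoint) c c.2 hcA)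
  let eP := LinearMap.linearEquivOfInjective _ hPinj hfAC.symm
  let eQ := LinearMap.linearEquivOfInjective _ hQinj hfBC.symm
  have hsymm := graphForm_comm hω hA hB hC hAB
  have hassoc : QuadraticMap.associated (R := ℝ) (graphForm ω hAB C).toQuadraticMap =
      graphForm ω hAB C := QuadraticMap.associated_left_inverse _ hsymm
  -- If `c` is in the kernel, `Pc` is orthogonal to `B`, hence lies in `A ∩ B = 0`.
  have hsep : (QuadraticMap.associated (R := ℝ) (graphForm ω hAB C).toQuadraticMap).SeparatingLeft
      := by
    rw [hassoc]
    intro c hc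
    apply hPinj
    rw [map_zero]
    have hmem : (A.projectionOnto B hAB c : T) ∈ B := (hB _).mpr fun y hy => by
      obtain ⟨c', hc'⟩ := eQ.surjective ⟨y, hy⟩
      have := hc c'
      rw [graphForm_apply] at this
      rw [← this]
      exact congrArg _ (congrArg Subtype.val hc').symm
    exact Subtype.ext ((Submodule.disjoint_def.mp hAB.disjoint) _ (Subtype.prop _) hmem)
  obtain ⟨ε, hε, ⟨e⟩⟩ :=
    QuadraticForm.equivalent_one_neg_one_weighted_sum_squared _ hsep
  let eV : EuclideanSpace ℝ (Fin (Module.finrank ℝ C)) ≃ₗ[ℝ] C :=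
    (WithLp.linearEquiv 2 ℝ _) ≪≫ₗ e.symm.toLinearEquiv
  refine ⟨ε, eV ≪≫ₗ eP, eV ≪≫ₗ eQ, eV, hε, fun z =>
    (projectionOnto_add_projectionOnto hAB (eV z : T)).symm, fun p q => ?_⟩
  have hsq : ∀ z, graphForm ω hAB C (eV z) (eV z) = diagForm ε z z := fun z => by
    have := e.symm.map_app (WithLp.linearEquiv 2 ℝ _ z)
    refine this.trans ?_
    rw [QuadraticMap.weightedSumSquares_apply]
    exact Finset.sum_congr rfl fun i _ => by
      simp only [smul_eq_mul, WithLp.linearEquiv_apply]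
      exact (mul_assoc _ _ _).symm
  change graphForm ω hAB C (eV p) (eV q) = _
  -- The two symmetric forms agree on the diagonal; polarize.
  have h1 := hsq (p + q)
  simp only [map_add, LinearMap.add_apply, diagForm_add_left, diagForm_add_right] at h1
  have := hsymm (eV p) (eV q)
  have := diagForm_comm ε p q
  linarith [hsq p, hsq q]

theorem apply_coordinates (hω : ω.IsAlt) {A B : Submodule ℝ T} (hA : IsLagrangian ω A)
    (hB : IsLagrangian ω B) {ι : Type*} [Fintype ι] {ε : ι → ℝ}
    (eA : EuclideanSpace ℝ ι ≃ₗ[ℝ] A) (eB : EuclideanSpace ℝ ι ≃ₗ[ℝ] B)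
    (hpair : ∀ p q, ω (eA p : T) (eB q) = diagForm ε p q)
    (p q p' q' : EuclideanSpace ℝ ι) :
    ω ((eA p : T) + eB q) ((eA p' : T) + eB q') = diagForm ε p q' - diagForm ε q p' := by
  have h1 := hω.neg_eq (eA p' : T) (eB q : T)
  simp only [map_add, LinearMap.add_apply, hA.apply_eq_zero, hB.apply_eq_zero, ← h1, hpair]
  rw [diagForm_comm ε p' q]
  ring

/-! ### The Maslov index in coordinates -/

theorem ncard_pos_sub_ncard_neg_eq_sum {ι : Type*} [Fintype ι] {w : ι → ℝ}
    (hw : ∀ i, w i = -1 ∨ w i = 1) :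
    (({i | 0 < w i}.ncard : ℝ) - {i | w i < 0}.ncard) = ∑ i, w i := by
  classical
  rw [Set.ncard_eq_toFinset_card', Set.ncard_eq_toFinset_card', Set.toFinset_ofPred,
    Set.toFinset_ofPred, Finset.card_filter, Finset.card_filter]
  push_cast
  rw [← Finset.sum_sub_distrib]
  refine Finset.sum_congr rfl fun i _ => ?_
  rcases hw i with h | h <;> simp [h]

/-- The linear change of variables `(x, y, z) ↦ (s - z, z, d)`, where `s = (x + y) / 2` and
`d = (x - y) / 2`, which turns `xy - yz - zx` into a difference of squares. -/
def kashiwaraCoordinates (ι : Type*) :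
    ((ι → ℝ) × (ι → ℝ) × (ι → ℝ)) ≃ₗ[ℝ] (ι ⊕ ι ⊕ ι → ℝ) where
  toFun v := Sum.elim (fun i => (v.1 i + v.2.1 i) / 2 - v.2.2 i)
    (Sum.elim v.2.2 fun i => (v.1 i - v.2.1 i) / 2)
  invFun k := (fun i => k (.inl i) + k (.inr (.inl i)) + k (.inr (.inr i)),
    fun i => k (.inl i) + k (.inr (.inl i)) - k (.inr (.inr i)), fun i => k (.inr (.inl i)))
  map_add' x y := by ext (i | i | i) <;> simp <;> ring
  map_smul' c x := by ext (i | i | i) <;> simp <;> ring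
  left_inv x := by
    refine Prod.ext ?_ (Prod.ext ?_ ?_) <;> ext i <;> simp <;> ring
  right_inv x := by ext (i | i | i) <;> simp

theorem maslovIndex_eq_neg_sum [FiniteDimensional ℝ T] (hω : ω.IsAlt) {A B C : Submodule ℝ T}
    (hA : IsLagrangian ω A) (hB : IsLagrangian ω B) {ι : Type*} [Fintype ι] {ε : ι → ℝ}
    (hε : ∀ i, ε i = -1 ∨ ε i = 1) (eA : EuclideanSpace ℝ ι ≃ₗ[ℝ] A)
    (eB : EuclideanSpace ℝ ι ≃ₗ[ℝ] B) (eC : EuclideanSpace ℝ ι ≃ₗ[ℝ] C)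
    (hC : ∀ z, (eC z : T) = eA z + eB z)
    (hpair : ∀ p q, ω (eA p : T) (eB q) = diagForm ε p q) :
    (maslovIndex ω A B C : ℝ) = -∑ i, ε i := by
  let w : ι ⊕ ι ⊕ ι → ℝ := Sum.elim ε (Sum.elim (-ε) (-ε))
  have hw : ∀ i, w i = -1 ∨ w i = 1 := by
    rintro (i | i | i) <;> rcases hε i with h | h <;> simp [w, h]
  let L := WithLp.linearEquiv 2 ℝ (ι → ℝ)
  let e : (A × B × C) ≃ₗ[ℝ] (ι ⊕ ι ⊕ ι → ℝ) :=
    ((eA.symm ≪≫ₗ L).prodCongr ((eB.symm ≪≫ₗ L).prodCongr (eC.symm ≪≫ₗ L))) ≪≫ₗ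
      kashiwaraCoordinates ι
  have hequiv : QuadraticMap.Equivalent (kashiwaraForm ω A B C)
      (QuadraticMap.weightedSumSquares ℝ w) := by
    refine ⟨⟨e, ?_⟩⟩
    rintro ⟨a, b, c⟩
    obtain ⟨x, rfl⟩ := eA.surjective a
    obtain ⟨y, rfl⟩ := eB.surjective b
    obtain ⟨z, rfl⟩ := eC.surjective c
    have h2 := hω.neg_eq (eA z : T) (eB y : T)
    have h3 := hω.neg_eq (eA x : T) (eB z : T)
    rw [kashiwaraForm_apply, hC]
    simp only [map_add, LinearMap.add_apply, hA.apply_eq_zero, hB.apply_eq_zero, ← h2, ← h3,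
      hpair, diagForm, QuadraticMap.weightedSumSquares_apply, Fintype.sum_sum_type, w, e, L,
      kashiwaraCoordinates]
    simp only [← Finset.sum_add_distrib, ← Finset.sum_neg_distrib]
    simp only [zero_add, add_zero, ← Finset.sum_add_distrib]
    refine Finset.sum_congr rfl fun i _ => ?_
    simp
    ring
  have hs := ncard_pos_sub_ncard_neg_eq_sum hw
  rw [maslovIndex, QuadraticForm.sigPos_of_equiv_weightedSumSquares hequiv,
    QuadraticForm.sigNeg_of_equiv_weightedSumSquares hequiv]
  push_cast
  rw [hs]
  simp [w, Fintype.sum_sum_type]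

end Coordinates

/-! ### Haar measures and Radon-Nikodym factors in coordinates -/

section Measures

theorem measurableEmbedding_linearEquiv {E F : Type*} [NormedAddCommGroup E] [NormedSpace ℝ E]
    [FiniteDimensional ℝ E] [MeasurableSpace E] [BorelSpace E] [NormedAddCommGroup F]
    [NormedSpace ℝ F] [MeasurableSpace F] [BorelSpace F] (e : E ≃ₗ[ℝ] F) : MeasurableEmbedding e :=
  have : FiniteDimensional ℝ F := e.finiteDimensional
  e.toContinuousLinearEquiv.toHomeomorph.measurableEmbedding

variable {ι : Type*} [Fintype ι] {X : Type*} [NormedAddCommGroup X] [NormedSpace ℝ X]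
  [MeasurableSpace X] [BorelSpace X]

theorem exists_eq_smul_map_volume (e : EuclideanSpace ℝ ι ≃ₗ[ℝ] X)
    (μ : Measure X) [μ.IsAddHaarMeasure] : ∃ c : NNReal, μ = c • volume.map e := by
  have : FiniteDimensional ℝ X := e.finiteDimensional
  have : (Measure.map e volume).IsAddHaarMeasure :=
    e.toContinuousLinearEquiv.isAddHaarMeasure_map volume
  exact ⟨_, Measure.isAddLeftInvariant_eq_smul μ (volume.map e)⟩

theorem integrable_smul_map_volume (e : EuclideanSpace ℝ ι ≃ₗ[ℝ] X)
    (c : NNReal) {F : X → ℂ} (hF : Integrable fun v => F (e v)) :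
    Integrable F (c • volume.map e) :=
  (((measurableEmbedding_linearEquiv e).integrable_map_iff).mpr hF).smul_measure_nnreal

theorem integral_smul_map_volume (e : EuclideanSpace ℝ ι ≃ₗ[ℝ] X)
    (c : NNReal) (F : X → ℂ) :
    ∫ x, F x ∂(c • volume.map e) = (c : ℂ) * ∫ v, F (e v) := by
  rw [integral_smul_nnreal_measure, (measurableEmbedding_linearEquiv e).integral_map,
    NNReal.smul_def, Complex.real_smul]

variable {T : Type*} [NormedAddCommGroup T] [NormedSpace ℝ T] [FiniteDimensional ℝ T]
  [MeasurableSpace T] [BorelSpace T]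

/-- The Radon-Nikodym factor of two transversal isotropic subspaces that are parametrized in such
a way that the pairing between them is diagonal with entries `±1`: the two parametrizations
combine to one of `T` that carries Lebesgue measure to the Liouville measure. -/
theorem rnFactor_smul_map_volume {ω : LinearMap.BilinForm ℝ T} (hω : ω.IsAlt)
    (hnd : ω.Nondegenerate) {X Y : Submodule ℝ T} (hX : IsLagrangian ω X) (hY : IsLagrangian ω Y)
    (hXY : IsCompl X Y) {w : ι → ℝ} (hw : ∀ i, w i = -1 ∨ w i = 1)
    (eX : EuclideanSpace ℝ ι ≃ₗ[ℝ] X) (eY : EuclideanSpace ℝ ι ≃ₗ[ℝ] Y)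
    (hpair : ∀ p q, ω (eX p : T) (eY q) = diagForm w p q)
    {a b : NNReal} {μ : Measure X} {ν : Measure Y} [μ.IsAddHaarMeasure] [ν.IsAddHaarMeasure]
    (hμ : μ = a • volume.map eX) (hν : ν = b • volume.map eY) :
    rnFactor ω μ ν = a * b := by
  classical
  let β := (EuclideanSpace.basisFun ι ℝ).toBasis
  let e : (EuclideanSpace ℝ ι × EuclideanSpace ℝ ι) ≃ₗ[ℝ] T :=
    (eX.prodCongr eY) ≪≫ₗ X.prodEquivOfIsCompl Y hXY
  have he : ∀ v, e v = (eX v.1 : T) + eY v.2 := fun v => rfl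
  have hvol : β.addHaar = volume := (EuclideanSpace.basisFun ι ℝ).addHaar_eq_volume
  let bT : Module.Basis (ι ⊕ ι) ℝ T := (β.prod β).map e.toContinuousLinearEquiv.toLinearEquiv
  have hbT : bT.addHaar = (volume.prod volume).map e := by
    have h1 := (β.prod β).map_addHaar e.toContinuousLinearEquiv
    rw [Module.Basis.prod_addHaar, hvol] at h1
    exact h1.symm
  have hinl : ∀ i, bT (Sum.inl i) = eX (EuclideanSpace.single i 1) := fun i => by
    simp [bT, β, he]
  have hinr : ∀ i, bT (Sum.inr i) = eY (EuclideanSpace.single i 1) := fun i => by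
    simp [bT, β, he]
  have hpair' : ∀ p q, ω (eY q : T) (eX p) = -diagForm w p q := fun p q => by
    rw [← hω.neg_eq, hpair]
  have hdiag : ∀ i j, diagForm w (EuclideanSpace.single i 1) (EuclideanSpace.single j 1) =
      Matrix.diagonal w i j := fun i j => by
    rcases eq_or_ne i j with rfl | h
    · simp [diagForm]
    · simp [diagForm, h, h.symm]
  have hM : LinearMap.BilinForm.toMatrix bT ω =
      Matrix.fromBlocks 0 (Matrix.diagonal w) (-Matrix.diagonal w) 0 := by
    ext (i | i) (j | j)
    · simp [LinearMap.BilinForm.toMatrix_apply, hinl, hX.apply_eq_zero]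
    · simp [LinearMap.BilinForm.toMatrix_apply, hinl, hinr, hpair, hdiag]
    · have hji : Matrix.diagonal w j i = Matrix.diagonal w i j := by
        rw [← Matrix.transpose_apply (Matrix.diagonal w), Matrix.diagonal_transpose]
      simp only [LinearMap.BilinForm.toMatrix_apply, hinl, hinr, hpair', hdiag, hji,
        Matrix.fromBlocks_apply₂₁, Matrix.neg_apply]
    · simp [LinearMap.BilinForm.toMatrix_apply, hinr, hY.apply_eq_zero]
  have hww : (Matrix.diagonal w * Matrix.diagonal w : Matrix ι ι ℝ) = 1 := by
    rw [Matrix.diagonal_mul_diagonal, ← Matrix.diagonal_one]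
    congr 1
    ext i
    rcases hw i with h | h <;> simp [h]
  -- `M * Mᵀ = 1`, so the Liouville density in this basis is `1`.
  have hdet : |(LinearMap.BilinForm.toMatrix bT ω).det| = 1 := by
    have h1 : (LinearMap.BilinForm.toMatrix bT ω) * (LinearMap.BilinForm.toMatrix bT ω).transpose
        = 1 := by
      rw [hM, Matrix.fromBlocks_transpose, Matrix.fromBlocks_multiply]
      simp only [Matrix.transpose_zero, Matrix.transpose_neg, Matrix.diagonal_transpose, zero_mul,
        mul_zero, neg_mul, mul_neg, neg_neg, neg_zero, zero_add, add_zero, hww,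
        Matrix.fromBlocks_one]
    have h2 := congrArg Matrix.det h1
    rw [Matrix.det_mul, Matrix.det_transpose, Matrix.det_one] at h2
    rw [← sq_eq_sq₀ (abs_nonneg _) zero_le_one, sq_abs, one_pow, sq, h2]
  have hL : liouvilleMeasure ω = (volume.prod volume).map e := by
    rw [liouvilleMeasure_eq_of_basis ω bT, liouvilleOfBasis, hdet, hbT]
    simp
  have hsum : sumMeasure μ ν = (a * b) • liouvilleMeasure ω := by
    have hme : MeasurableEmbedding (Prod.map eX eY) :=
      measurableEmbedding_linearEquiv (eX.prodCongr eY)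
    have hadd : Measurable fun p : X × Y => (p.1 : T) + (p.2 : T) := by fun_prop
    rw [sumMeasure, hμ, hν, Measure.prod_smul_left, Measure.prod_smul_right, smul_smul,
      Measure.map_prod_map _ _ (measurableEmbedding_linearEquiv eX).measurable
        (measurableEmbedding_linearEquiv eY).measurable, Measure.map_smul,
      Measure.map_map hadd hme.measurable, hL]
    rfl
  obtain ⟨hpos, hrn⟩ := sumMeasure_eq_rnFactor_smul hnd hXY μ ν
  have hHaar : (liouvilleMeasure ω).IsAddHaarMeasure := by
    rw [hL]
    exact e.toContinuousLinearEquiv.isAddHaarMeasure_map (volume.prod volume)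
  have hball := congrArg (fun m : Measure T => m (Metric.closedBall 0 1)) (hrn.symm.trans hsum)
  have hne : liouvilleMeasure ω (Metric.closedBall 0 1) ≠ 0 :=
    (Metric.measure_closedBall_pos _ _ one_pos).ne'
  have htop : liouvilleMeasure ω (Metric.closedBall 0 1) ≠ ⊤ :=
    (isCompact_closedBall _ _).measure_lt_top.ne
  simp only [Measure.smul_apply, ENNReal.smul_def, smul_eq_mul] at hball
  have hc := (ENNReal.mul_left_inj hne htop).mp hball
  have := congrArg ENNReal.toReal hc
  rwa [ENNReal.toReal_ofReal hpos.le, ENNReal.coe_toReal, NNReal.coe_mul] at this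

end Measures

/-! ### The triple convolution -/

section Left

variable {T : Type*} [AddCommGroup T] [Module ℝ T] {ω : LinearMap.BilinForm ℝ T}

/-- Inversion in the Heisenberg group exchanges the two inductions, at the price of `h ↦ -h` and
a reflection of `f`. -/
theorem indLeft_eq_indRight_inv (hω : ω.IsAlt) {A B : Submodule ℝ T} (hA : IsLagrangian ω A)
    (hAB : IsCompl A B) (h : ℝ) (f : A → ℂ) :
    (fun z => indLeft ω h hAB f z⁻¹) = indRight ω (-h) hAB fun a => f (-a) := by
  funext z
  have hz : ω (A.projectionOnto B hAB z.x : T) z.x =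
      ω (A.projectionOnto B hAB z.x : T) (B.projectionOnto A hAB.symm z.x) := by
    conv_lhs => rw [← projectionOnto_add_projectionOnto hAB z.x]
    rw [projectionOnto_add_projectionOnto hAB z.x]
    nth_rewrite 2 [← projectionOnto_add_projectionOnto hAB z.x]
    rw [map_add, hA.apply_eq_zero, zero_add]
  simp only [indLeft, indRight, Heisenberg.inv_eq_of_isAlt hω, map_neg, LinearMap.neg_apply,
    Submodule.coe_neg, neg_neg, hz, ehChar]
  congr 2
  ring

theorem ofVec_inv_mul (x : T) (z : Heisenberg ω) :
    (Heisenberg.ofVec ω x)⁻¹ * z = (z⁻¹ * Heisenberg.ofVec ω x)⁻¹ := by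
  rw [mul_inv_rev, inv_inv]

variable [MeasurableSpace T] {X : Submodule ℝ T}

theorem convLeft_eq_convRight_inv (μ : Measure X) (F : Heisenberg ω → ℂ) :
    (fun z => convLeft μ F z⁻¹) = convRight μ fun z => F z⁻¹ := by
  funext z
  simp only [convLeft, convRight, ofVec_inv_mul, inv_inv]

theorem convLeftConverges_iff (μ : Measure X) (F : Heisenberg ω → ℂ) :
    ConvLeftConverges μ F ↔ ConvRightConverges μ fun z => F z⁻¹ := by
  simp only [ConvLeftConverges, ConvRightConverges, ofVec_inv_mul]
  exact ⟨fun H z => by simpa using H z⁻¹, fun H z => by simpa using H z⁻¹⟩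

end Left

theorem ehChar_eq (h t : ℝ) : ehChar h t = eChar (2 * h * t) := rfl

/-- The constant produced by the three convolutions, rewritten in terms of `|h|`, `sgn h` and the
signature. -/
theorem prod_fresnel_constant {n : ℕ} {ε : Fin n → ℝ} (hε : ∀ i, ε i = -1 ∨ ε i = 1) {h : ℝ}
    (hh : h ≠ 0) {τ : ℝ} (hτ : τ = -∑ i, ε i) :
    (∏ i, ((|(h • ε) i| ^ (-(1 / 2) : ℝ) : ℝ) : ℂ) * eChar (Real.sign ((h • ε) i) / 4)) *
        ((∏ i, |(h • ε) i|)⁻¹ : ℝ) =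
      ((|h| ^ (-(3 * n / 2) : ℝ) : ℝ) : ℂ) * eChar (-(Real.sign h / 4) * τ) := by
  have habs : ∀ i, |(h • ε) i| = |h| := fun i => by
    rcases hε i with hi | hi <;> simp [hi]
  have hsign : ∀ i, Real.sign ((h • ε) i) / 4 = Real.sign h / 4 * ε i := fun i => by
    rcases hε i with hi | hi
    · simp [hi, Real.sign_neg]
      ring
    · simp [hi]
  have hpos : 0 < |h| := abs_pos.mpr hh
  simp only [habs, hsign]
  rw [Finset.prod_mul_distrib, ← eChar_sum, ← Finset.mul_sum, Finset.prod_const, Finset.prod_const,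
    Finset.card_univ, Fintype.card_fin, hτ, neg_mul_neg]
  have hpow : (|h| ^ (-(1 / 2) : ℝ)) ^ n * (|h| ^ n)⁻¹ = |h| ^ (-(3 * n / 2) : ℝ) := by
    rw [← Real.rpow_mul_natCast hpos.le, ← Real.rpow_natCast, ← Real.rpow_neg hpos.le,
      ← Real.rpow_add hpos]
    congr 1
    ring
  rw [← hpow]
  push_cast
  ring

section Right

variable {T : Type*} [NormedAddCommGroup T] [NormedSpace ℝ T]
  [MeasurableSpace T] [BorelSpace T] {ω : LinearMap.BilinForm ℝ T} {ι : Type*} [Fintype ι]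

/-- If the integrand of a convolution is, in coordinates, a constant times a translate of an
integrable function, then the convolution converges and its value is known. -/
theorem convRight_of_translate {X : Submodule ℝ T} (e : EuclideanSpace ℝ ι ≃ₗ[ℝ] X) {c : NNReal}
    {μ : Measure X} (hμ : μ = c • volume.map e) {F : Heisenberg ω → ℂ} {z : Heisenberg ω}
    {a : ℂ} {H : EuclideanSpace ℝ ι → ℂ} (hH : Integrable H) (p : EuclideanSpace ℝ ι)
    (hF : ∀ v, F (z * Heisenberg.ofVec ω (e v : T)) = a * H (p + v)) :
    Integrable (fun x : X => F (z * Heisenberg.ofVec ω (x : T))) μ ∧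
      convRight μ F z = c * (a * ∫ v, H v) := by
  subst hμ
  refine ⟨integrable_smul_map_volume e c ?_, ?_⟩
  · simp only [hF]
    exact (hH.comp_add_left p).const_mul a
  · rw [convRight, integral_smul_map_volume]
    simp only [hF]
    rw [integral_const_mul, integral_add_left_eq_self H p]

/-- The triple convolution for the right action, in adapted coordinates: the first convolution is
a Fourier transform, the second multiplies by a chirp and transforms back, and the third is a
convolution with the same chirp. -/
theorem convRight_triple_coordinates (hω : ω.IsAlt) {A B C : Submodule ℝ T}
    (hA : IsLagrangian ω A) (hB : IsLagrangian ω B) (hAB : IsCompl A B)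
    {ε : ι → ℝ} (eA : EuclideanSpace ℝ ι ≃ₗ[ℝ] A)
    (eB : EuclideanSpace ℝ ι ≃ₗ[ℝ] B) (eC : EuclideanSpace ℝ ι ≃ₗ[ℝ] C)
    (heC : ∀ z, (eC z : T) = eA z + eB z)
    (hpair : ∀ p q, ω (eA p : T) (eB q) = diagForm ε p q)
    {a b c : NNReal} {μA : Measure A} {μB : Measure B} {μC : Measure C}
    (hμA : μA = a • volume.map eA) (hμB : μB = b • volume.map eB) (hμC : μC = c • volume.map eC)
    {h : ℝ} (hd : ∀ i, (h • ε) i ≠ 0) (f : 𝓢(A, ℂ)) :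
    ConvRightConverges μA (indRight ω h hAB f) ∧
      ConvRightConverges μC (convRight μA (indRight ω h hAB f)) ∧
      ConvRightConverges μB (convRight μC (convRight μA (indRight ω h hAB f))) ∧
      convRight μB (convRight μC (convRight μA (indRight ω h hAB f))) =
        (a * b * c * ((∏ i, ((|(h • ε) i| ^ (-(1 / 2) : ℝ) : ℝ) : ℂ) *
          eChar (Real.sign ((h • ε) i) / 4)) * ((∏ i, |(h • ε) i|)⁻¹ : ℝ)) : ℂ) •
            indRight ω h hAB f := by
  set d := h • ε with hdef
  have hdε : ∀ p q, diagForm d p q = h * diagForm ε p q := fun p q =>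
    diagForm_smul_weight ε p q h
  let u : 𝓢(EuclideanSpace ℝ ι, ℂ) :=
    SchwartzMap.compCLMOfContinuousLinearEquiv ℂ eA.toContinuousLinearEquiv f
  have hu : ∀ p, f (eA p) = u p := fun p => rfl
  obtain ⟨G, hG⟩ := exists_schwartzMap_eq_integral_diagForm hd u
  have hchirp := hasTemperateGrowth_eChar_diagForm d
  let k : 𝓢(EuclideanSpace ℝ ι, ℂ) :=
    SchwartzMap.smulLeftCLM ℂ (fun z => eChar (diagForm d z z)) G
  have hk : ∀ z, k z = eChar (diagForm d z z) * G z := fun z =>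
    SchwartzMap.smulLeftCLM_apply_apply hchirp G z
  -- The inverse transform is the transform for the weights `-d`.
  obtain ⟨ψ, hψ'⟩ := exists_schwartzMap_eq_integral_diagForm
    (d := -d) (fun i => neg_ne_zero.mpr (hd i)) k
  have hψ : ∀ x, ψ x = ∫ z, eChar (2 * diagForm d x z) * (eChar (diagForm d z z) * G z) := by
    intro x
    rw [hψ']
    simp only [diagForm_neg_weight, hk, diagForm_comm d x, mul_neg, neg_neg]
  have hbdd : ∀ (φ : 𝓢(EuclideanSpace ℝ ι, ℂ)) {g : EuclideanSpace ℝ ι → ℝ}, Continuous g →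
      Integrable fun v => eChar (g v) * φ v := fun φ g hg =>
    φ.integrable.bdd_mul (c := 1) (Continuous.aestronglyMeasurable (by fun_prop))
      (Filter.Eventually.of_forall fun y => (norm_eChar _).le)
  have hcoord : ∀ z : Heisenberg ω, ∃ s p q, z = ⟨s, (eA p : T) + eB q⟩ := fun z =>
    ⟨z.s, eA.symm (A.projectionOnto B hAB z.x), eB.symm (B.projectionOnto A hAB.symm z.x), by
      ext
      · rfl
      · simpa using (projectionOnto_add_projectionOnto hAB z.x).symm⟩
  have hmul : ∀ s p q p' q', (⟨s, (eA p : T) + eB q⟩ : Heisenberg ω) *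
      Heisenberg.ofVec ω ((eA p' : T) + eB q') =
      ⟨s + (diagForm ε p q' - diagForm ε q p') / 2, (eA (p + p') : T) + eB (q + q')⟩ := by
    intro s p q p' q'
    rw [← apply_coordinates hω hA hB eA eB hpair]
    ext
    · simp [Heisenberg.mul_def, Heisenberg.ofVec]
    · simp only [Heisenberg.mul_def, Heisenberg.ofVec, map_add, Submodule.coe_add]
      abel
  have h0 : ∀ s p q, indRight ω h hAB f ⟨s, (eA p : T) + eB q⟩ =
      ehChar h (s - diagForm ε p q / 2) * u p := by
    intro s p q
    simp only [indRight, projectionOnto_coe_add_left hAB, projectionOnto_coe_add_right hAB,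
      hpair, hu]
  -- Convolution with `δ_A`, after the substitution `v ↦ v - p`: a Fourier transform.
  have h1 : ∀ s p q, Integrable (fun x : A => indRight ω h hAB f
        (⟨s, (eA p : T) + eB q⟩ * Heisenberg.ofVec ω (x : T))) μA ∧
      convRight μA (indRight ω h hAB f) ⟨s, (eA p : T) + eB q⟩ =
        a * (ehChar h (s + diagForm ε p q / 2) * G q) := by
    intro s p q
    rw [hG q]
    refine convRight_of_translate eA hμA (hbdd u (by fun_prop)) p fun v => ?_
    have := hmul s p q v 0
    rw [map_zero, Submodule.coe_zero, add_zero, add_zero, diagForm_zero_right] at this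
    rw [this, h0, ehChar_eq, ehChar_eq, ← mul_assoc, ← eChar_add, hdε, diagForm_add_left,
      diagForm_comm ε q v]
    congr 2
    ring
  -- Convolution with `δ_C`, after the substitution `v ↦ v - q`: a chirp and the inverse transform.
  have h2 : ∀ s p q, Integrable (fun x : C => convRight μA (indRight ω h hAB f)
        (⟨s, (eA p : T) + eB q⟩ * Heisenberg.ofVec ω (x : T))) μC ∧
      convRight μC (convRight μA (indRight ω h hAB f)) ⟨s, (eA p : T) + eB q⟩ =
        c * (a * ehChar h (s - diagForm ε (p - q) q / 2) * ψ (p - q)) := by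
    intro s p q
    rw [hψ (p - q)]
    have hint : Integrable fun z =>
        eChar (2 * diagForm d (p - q) z) * (eChar (diagForm d z z) * G z) := by
      simp only [← hk]
      exact hbdd k (by fun_prop)
    refine convRight_of_translate eC hμC hint q fun v => ?_
    rw [heC, hmul, (h1 _ _ _).2, ehChar_eq, ehChar_eq]
    have hphase : eChar (2 * h * (s + (diagForm ε p v - diagForm ε q v) / 2 +
          diagForm ε (p + v) (q + v) / 2)) =
        eChar (2 * h * (s - diagForm ε (p - q) q / 2)) * eChar (2 * diagForm d (p - q) (q + v)) *
          eChar (diagForm d (q + v) (q + v)) := by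
      rw [← eChar_add, ← eChar_add, hdε, hdε]
      congr 1
      simp only [diagForm_add_left, diagForm_add_right, diagForm_sub_left]
      rw [diagForm_comm ε v q]
      ring
    rw [hphase]
    ring
  -- Convolution with `δ_B`, after the substitution `v ↦ v - q`: convolution with the chirp.
  have h3 : ∀ s p q, Integrable (fun x : B => convRight μC (convRight μA (indRight ω h hAB f))
        (⟨s, (eA p : T) + eB q⟩ * Heisenberg.ofVec ω (x : T))) μB ∧
      convRight μB (convRight μC (convRight μA (indRight ω h hAB f))) ⟨s, (eA p : T) + eB q⟩ =
        b * (c * a * ehChar h (s - diagForm ε p q / 2) *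
          ∫ y, eChar (diagForm d y y) * ψ (p - y)) := by
    intro s p q
    have hint : Integrable fun y => eChar (diagForm d y y) * ψ (p - y) :=
      (ψ.integrable.comp_sub_left p).bdd_mul (c := 1)
        (Continuous.aestronglyMeasurable (by fun_prop))
        (Filter.Eventually.of_forall fun y => (norm_eChar _).le)
    refine convRight_of_translate eB hμB hint q fun v => ?_
    have := hmul s p q 0 v
    rw [map_zero, Submodule.coe_zero, zero_add, add_zero, diagForm_zero_right, sub_zero] at this
    rw [this, (h2 _ _ _).2, ehChar_eq, ehChar_eq]
    have hphase : eChar (2 * h * (s + diagForm ε p v / 2 - diagForm ε (p - (q + v)) (q + v) / 2)) =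
        eChar (2 * h * (s - diagForm ε p q / 2)) * eChar (diagForm d (q + v) (q + v)) := by
      rw [← eChar_add, hdε]
      congr 1
      simp only [diagForm_add_left, diagForm_add_right, diagForm_sub_left]
      ring
    rw [hphase]
    ring
  refine ⟨fun z => ?_, fun z => ?_, fun z => ?_, ?_⟩
  · obtain ⟨s, p, q, rfl⟩ := hcoord z
    exact (h1 s p q).1
  · obtain ⟨s, p, q, rfl⟩ := hcoord z
    exact (h2 s p q).1
  · obtain ⟨s, p, q, rfl⟩ := hcoord z
    exact (h3 s p q).1
  · funext z
    obtain ⟨s, p, q, rfl⟩ := hcoord z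
    rw [(h3 s p q).2, Pi.smul_apply, smul_eq_mul, h0,
      integral_chirp_mul_comp_sub hd G.integrable ψ.integrable hψ,
      integral_eChar_diagForm_mul_of_eq_integral hd u G hG]
    ring

variable [FiniteDimensional ℝ T]

theorem convRight_triple {n : ℕ} (hn : Module.finrank ℝ T = 2 * n) (hω : IsSymplecticForm ω)
    {A B C : Submodule ℝ T} (hA : IsLagrangian ω A) (hB : IsLagrangian ω B)
    (hC : IsLagrangian ω C) (hAB : IsCompl A B) (hBC : IsCompl B C) (hCA : IsCompl C A)
    (μA : Measure A) (μB : Measure B) (μC : Measure C)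
    [μA.IsAddHaarMeasure] [μB.IsAddHaarMeasure] [μC.IsAddHaarMeasure]
    {h : ℝ} (hh : h ≠ 0) (f : 𝓢(A, ℂ)) :
    ConvRightConverges μA (indRight ω h hAB f) ∧
      ConvRightConverges μC (convRight μA (indRight ω h hAB f)) ∧
      ConvRightConverges μB (convRight μC (convRight μA (indRight ω h hAB f))) ∧
      convRight μB (convRight μC (convRight μA (indRight ω h hAB f))) =
        (((|h| ^ (-(3 * n / 2) : ℝ) *
            Real.sqrt (rnFactor ω μA μB * rnFactor ω μB μC * rnFactor ω μC μA) : ℝ) : ℂ) *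
          eChar (-(Real.sign h / 4) * maslovIndex ω A B C)) • indRight ω h hAB f := by
  obtain ⟨halt, hnd⟩ := hω
  obtain ⟨ε, eA, eB, eC, hε, heC, hpair⟩ :=
    exists_adapted_coordinates hn halt hA hB hC hAB hBC hCA
  obtain ⟨a, hμA⟩ := exists_eq_smul_map_volume eA μA
  obtain ⟨b, hμB⟩ := exists_eq_smul_map_volume eB μB
  obtain ⟨c, hμC⟩ := exists_eq_smul_map_volume eC μC
  have hε' : ∀ i, (-ε) i = -1 ∨ (-ε) i = 1 := fun i => by
    rcases hε i with hi | hi <;> simp [hi]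
  have hpairBA : ∀ p q, ω (eB p : T) (eA q) = diagForm (-ε) p q := fun p q => by
    rw [← halt.neg_eq, hpair, diagForm_neg_weight, diagForm_comm]
  have hpairBC : ∀ p q, ω (eB p : T) (eC q) = diagForm (-ε) p q := fun p q => by
    rw [heC, map_add, hB.apply_eq_zero, add_zero, hpairBA]
  have hpairCA : ∀ p q, ω (eC p : T) (eA q) = diagForm (-ε) p q := fun p q => by
    rw [heC, map_add, LinearMap.add_apply, hA.apply_eq_zero, zero_add, hpairBA]
  have hd : ∀ i, (h • ε) i ≠ 0 := fun i => by
    rcases hε i with hi | hi <;> simp [hi, hh]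
  -- Each of the scalars `a`, `b`, `c` occurs in two of the three factors.
  have hsqrt : Real.sqrt (rnFactor ω μA μB * rnFactor ω μB μC * rnFactor ω μC μA) =
      a * b * c := by
    rw [rnFactor_smul_map_volume halt hnd hA hB hAB hε eA eB hpair hμA hμB,
      rnFactor_smul_map_volume halt hnd hB hC hBC hε' eB eC hpairBC hμB hμC,
      rnFactor_smul_map_volume halt hnd hC hA hCA hε' eC eA hpairCA hμC hμA,
      show (a * b * (b * c) * (c * a) : ℝ) = (a * b * c) ^ 2 by ring]
    exact Real.sqrt_sq (by positivity)
  obtain ⟨h1, h2, h3, h4⟩ := convRight_triple_coordinates halt hA hB hAB eA eB eC heC hpair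
    hμA hμB hμC hd f
  refine ⟨h1, h2, h3, h4.trans ?_⟩
  rw [prod_fresnel_constant hε hh (maslovIndex_eq_neg_sum halt hA hB hε eA eB eC heC hpair), hsqrt]
  congr 1
  push_cast
  ring

end Right

end

theorem mainTheorem1 {T : Type*} [NormedAddCommGroup T] [NormedSpace ℝ T]
    [FiniteDimensional ℝ T] [MeasurableSpace T] [BorelSpace T]
    (n : ℕ) (hn : Module.finrank ℝ T = 2 * n)
    (ω : LinearMap.BilinForm ℝ T) (hω : IsSymplecticForm ω)
    (A B C : Submodule ℝ T)
    (hA : IsLagrangian ω A) (hB : IsLagrangian ω B) (hC : IsLagrangian ω C)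
    (hAB : IsCompl A B) (hBC : IsCompl B C) (hCA : IsCompl C A)
    (μA : Measure A) (μB : Measure B) (μC : Measure C)
    [μA.IsAddHaarMeasure] [μB.IsAddHaarMeasure] [μC.IsAddHaarMeasure]
    (h : ℝ) (hh : h ≠ 0) (f : 𝓢(A, ℂ)) :
    (ConvRightConverges μA (indRight ω h hAB f) ∧
      ConvRightConverges μC (convRight μA (indRight ω h hAB f)) ∧
      ConvRightConverges μB (convRight μC (convRight μA (indRight ω h hAB f))) ∧
      convRight μB (convRight μC (convRight μA (indRight ω h hAB f))) =
        (((|h| ^ (-(3 * n / 2) : ℝ) *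
            Real.sqrt (rnFactor ω μA μB * rnFactor ω μB μC * rnFactor ω μC μA) : ℝ) : ℂ) *
          eChar (-(Real.sign h / 4) * maslovIndex ω A B C)) • indRight ω h hAB f) ∧
    (ConvLeftConverges μA (indLeft ω h hAB f) ∧
      ConvLeftConverges μC (convLeft μA (indLeft ω h hAB f)) ∧
      ConvLeftConverges μB (convLeft μC (convLeft μA (indLeft ω h hAB f))) ∧
      convLeft μB (convLeft μC (convLeft μA (indLeft ω h hAB f))) =
        (((|h| ^ (-(3 * n / 2) : ℝ) *
            Real.sqrt (rnFactor ω μA μB * rnFactor ω μB μC * rnFactor ω μC μA) : ℝ) : ℂ) *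
          eChar ((Real.sign h / 4) * maslovIndex ω A B C)) • indLeft ω h hAB f) := by
  refine ⟨convRight_triple hn hω hA hB hC hAB hBC hCA μA μB μC hh f, ?_⟩
  let g : 𝓢(A, ℂ) :=
    SchwartzMap.compCLMOfContinuousLinearEquiv ℂ (ContinuousLinearEquiv.neg ℝ) f
  have hind : (fun z => indLeft ω h hAB f z⁻¹) = indRight ω (-h) hAB g :=
    indLeft_eq_indRight_inv hω.1 hA hAB h f
  obtain ⟨h1, h2, h3, h4⟩ :=
    convRight_triple hn hω hA hB hC hAB hBC hCA μA μB μC (neg_ne_zero.mpr hh) g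
  simp only [convLeftConverges_iff, convLeft_eq_convRight_inv, hind]
  refine ⟨h1, h2, h3, ?_⟩
  have h5 : (fun z => convLeft μB (convLeft μC (convLeft μA (indLeft ω h hAB f))) z⁻¹) =
      convRight μB (convRight μC (convRight μA (indRight ω (-h) hAB g))) := by
    simp only [convLeft_eq_convRight_inv, hind]
  rw [h4, ← hind] at h5
  funext z
  have h6 := congrFun h5 z⁻¹
  rw [inv_inv] at h6
  rw [h6, Pi.smul_apply, Pi.smul_apply, inv_inv, abs_neg, Real.sign_neg, neg_div, neg_neg]
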